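/- Let $k$ be an algebraically closed field of characteristic zero and let $G$ be a finite group. Let $\mathcal{R}ep(G)$ be the braided (symmetric) tensor category of finite dimensional representations of $G$ over $k$. A braided tensor autoequivalence of $\mathcal{R}ep(G)$ is a $k$-linear equivalence of categories $F:\mathcal{R}ep(G)\to\mathcal{R}ep(G)$ equipped with a (strong) monoidal structure compatible with the braiding; it is called dualising if $F(X)\simeq X^*$ for every object $X$, where $X^*$ is the dual object. An automorphism $\varphi$ of $G$ is called class-inverting if for every $g\in G$ there is $h\in G$ such that $\varphi(g)=hg^{-1}h^{-1}$. Then $\mathcal{R}ep(G)$ has a dualising braided tensor autoequivalence if and only if $G$ has a class-inverting automorphism. -/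

import Mathlib

open CategoryTheory

universe w v u

/-- A braided tensor autoequivalence of a braided tensor category `C` over `k`: a `k`-linear
equivalence of categories `C ⥤ C` together with a (strong) monoidal structure which is compatible
with the braiding. -/
structure BraidedTensorAutoequivalence (k : Type w) [Field k] (C : Type u) [Category.{v} C]
    [Preadditive C] [Linear k C] [MonoidalCategory C] [BraidedCategory C] where
  /-- the underlying functor -/
  functor : C ⥤ C
  /-- the monoidal structure of the functor, which respects the braiding -/
  braided : functor.Braided
  additive : functor.Additive
  linear : functor.Linear k
  isEquivalence : functor.IsEquivalence

/-- A braided tensor autoequivalence `F` is dualising if `F(X)` is isomorphic to the dual object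
`X*` for every object `X`. -/
def BraidedTensorAutoequivalence.IsDualising {k : Type w} [Field k] {C : Type u} [Category.{v} C]
    [Preadditive C] [Linear k C] [MonoidalCategory C] [BraidedCategory C] [RightRigidCategory C]
    (F : BraidedTensorAutoequivalence k C) : Prop :=
  ∀ X : C, Nonempty (F.functor.obj X ≅ Xᘁ)

/-- A group automorphism `φ` is class-inverting if `φ(g)` is conjugate to `g⁻¹` for every `g`. -/
def IsClassInverting {G : Type u} [Group G] (φ : G ≃* G) : Prop :=
  ∀ g : G, ∃ h : G, φ g = h * g⁻¹ * h⁻¹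

/-! In characteristic zero, characters determine representations. Restriction along a
class-inverting `φ` turns the character of `X` into that of `Xᘁ`, so it is dualising.

Conversely, a dualising `F` preserves dimensions. Let `A` be the algebra of functions on `G`, a
commutative algebra in the category. Then `F(A)` is again a nonzero commutative algebra, so over an
algebraically closed field it has a multiplicative functional `χ`. Each `ξ` in the dual of `X` gives
a matrix coefficient map `X ⟶ A`; applying `F` and then `χ` gives a functional on `F(X)`. This
`transport` is injective, hence bijective by dimension. It identifies `F(A)` with functions on `G`,
so `χ ∘ ρ(g)` is evaluation at some point `φ(g)`. This `φ` is an endomorphism of `G`, and the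
character of `F(X)` at `g` is that of `X` at `φ(g)`. Duality makes it also that of `X` at `g⁻¹`; as
characters separate conjugacy classes, `φ(g)` is conjugate to `g⁻¹`. So `φ` has trivial kernel and
is an automorphism. -/

open scoped TensorProduct MonoidAlgebra MonoidalCategory

/-- A nonzero finite-dimensional commutative algebra over an algebraically closed field, presented
by a bilinear multiplication, has a character. -/
theorem LinearMap.exists_multiplicative_functional {k V : Type*} [Field k] [IsAlgClosed k]
    [AddCommGroup V] [Module k V] [FiniteDimensional k V] [Nontrivial V]
    (m : V →ₗ[k] V →ₗ[k] V) (e : V) (he : ∀ x, m e x = x) (hcomm : ∀ x y, m x y = m y x)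
    (hassoc : ∀ x y z, m (m x y) z = m x (m y z)) :
    ∃ χ : V →ₗ[k] k, χ e = 1 ∧ ∀ x y, χ (m x y) = χ x * χ y := by
  let _ : CommRing V :=
    { ‹AddCommGroup V› with
      mul := fun x y => m x y
      one := e
      mul_assoc := hassoc
      one_mul := he
      mul_one := fun x => (hcomm x e).trans (he x)
      mul_comm := hcomm
      left_distrib := fun x y z => (m x).map_add y z
      right_distrib := fun x y z => LinearMap.congr_fun (m.map_add x y) z
      zero_mul := fun x => LinearMap.congr_fun m.map_zero x
      mul_zero := fun x => (m x).map_zero }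
  let _ : Algebra k V := Algebra.ofModule
    (fun r x y => LinearMap.congr_fun (m.map_smul r x) y) (fun r x y => (m x).map_smul r y)
  -- The residue field at a maximal ideal is a finite extension of `k`, hence embeds in `k`.
  obtain ⟨I, hI⟩ := Ideal.exists_maximal V
  let _ := Ideal.Quotient.field I
  have : Module.Finite k (V ⧸ I) := Module.Finite.of_surjective
    (Ideal.Quotient.mkₐ k I).toLinearMap (Ideal.Quotient.mkₐ_surjective k I)
  let χ : V →ₐ[k] k := (IsAlgClosed.lift : (V ⧸ I) →ₐ[k] k).comp (Ideal.Quotient.mkₐ k I)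
  exact ⟨χ.toLinearMap, map_one χ, map_mul χ⟩

/-! ### Characters determine representations -/

/-- The trace of an endomorphism preserving two complementary subspaces. -/
theorem LinearMap.trace_eq_add_trace_restrict {k V : Type*} [Field k] [AddCommGroup V]
    [Module k V] [FiniteDimensional k V] {p q : Submodule k V} (h : IsCompl p q) (f : V →ₗ[k] V)
    (hp : ∀ x ∈ p, f x ∈ p) (hq : ∀ x ∈ q, f x ∈ q) :
    trace k V f = trace k p (f.restrict hp) + trace k q (f.restrict hq) := by
  rw [← trace_prodMap', ← trace_conj' _ (Submodule.prodEquivOfIsCompl p q h)]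
  congr 1
  refine LinearMap.ext fun x => ?_
  obtain ⟨⟨a, b⟩, rfl⟩ := (Submodule.prodEquivOfIsCompl p q h).surjective x
  simp [LinearEquiv.conj_apply]

namespace Representation

variable {k G : Type*} [Field k] [Group G]

theorem character_eq_add {V : Type*} [AddCommGroup V] [Module k V] [FiniteDimensional k V]
    {ρ : Representation k G V} {p q : Subrepresentation ρ} (h : IsCompl p q) (g : G) :
    ρ.character g = p.toRepresentation.character g + q.toRepresentation.character g :=
  LinearMap.trace_eq_add_trace_restrict
    (p := p.toSubmodule) (q := q.toSubmodule)
    ⟨disjoint_iff.2 (congrArg Subrepresentation.toSubmodule h.inf_eq_bot),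
      codisjoint_iff.2 (congrArg Subrepresentation.toSubmodule h.sup_eq_top)⟩
    (ρ g) (p.apply_mem_toSubmodule g) (q.apply_mem_toSubmodule g)

theorem exists_intertwining_of_isCompl {V W : Type*} [AddCommGroup V] [Module k V]
    [AddCommGroup W] [Module k W] {ρ : Representation k G V} {σ : Representation k G W}
    {p q : Subrepresentation ρ} (h : IsCompl p q) {p' q' : Subrepresentation σ}
    (h' : IsCompl p' q')
    (e : p.toSubmodule ≃ₗ[k] p'.toSubmodule) (f : q.toSubmodule ≃ₗ[k] q'.toSubmodule)
    (he : ∀ g x, e (p.toRepresentation g x) = p'.toRepresentation g (e x))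
    (hf : ∀ g x, f (q.toRepresentation g x) = q'.toRepresentation g (f x)) :
    ∃ t : V ≃ₗ[k] W, ∀ g x, t (ρ g x) = σ g (t x) := by
  have h1 : IsCompl p.toSubmodule q.toSubmodule :=
    ⟨disjoint_iff.2 (congrArg Subrepresentation.toSubmodule h.inf_eq_bot),
      codisjoint_iff.2 (congrArg Subrepresentation.toSubmodule h.sup_eq_top)⟩
  have h2 : IsCompl p'.toSubmodule q'.toSubmodule :=
    ⟨disjoint_iff.2 (congrArg Subrepresentation.toSubmodule h'.inf_eq_bot),
      codisjoint_iff.2 (congrArg Subrepresentation.toSubmodule h'.sup_eq_top)⟩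
  refine ⟨(Submodule.prodEquivOfIsCompl _ _ h1).symm ≪≫ₗ (e.prodCongr f) ≪≫ₗ
    (Submodule.prodEquivOfIsCompl _ _ h2), fun g x => ?_⟩
  obtain ⟨⟨a, b⟩, rfl⟩ := (Submodule.prodEquivOfIsCompl _ _ h1).surjective x
  have key : ρ g (Submodule.prodEquivOfIsCompl _ _ h1 (a, b)) =
      Submodule.prodEquivOfIsCompl _ _ h1 (p.toRepresentation g a, q.toRepresentation g b) := by
    simp [Subrepresentation.toRepresentation]
  rw [key]
  simp [he, hf]
  simp [Subrepresentation.toRepresentation]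

/-- Finite-dimensional representations of a finite group in characteristic zero with equal
characters are isomorphic. -/
theorem exists_intertwining_of_character_eq [Finite G] [CharZero k] (n : ℕ) :
    ∀ {V W : Type*} [AddCommGroup V] [Module k V] [FiniteDimensional k V]
      [AddCommGroup W] [Module k W] [FiniteDimensional k W]
      (ρ : Representation k G V) (σ : Representation k G W),
      Module.finrank k V ≤ n → ρ.character = σ.character →
      ∃ t : V ≃ₗ[k] W, ∀ g x, t (ρ g x) = σ g (t x) := by
  have := Fintype.ofFinite G
  have : NeZero (Nat.card G : k) := ⟨Nat.cast_ne_zero.2 Nat.card_pos.ne'⟩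
  let _ : Invertible (Nat.card G : k) := invertibleOfNonzero (NeZero.ne _)
  induction n with
  | zero =>
    intro V W _ _ _ _ _ _ ρ σ hn hχ
    have hdim : Module.finrank k V = Module.finrank k W := by
      have := congrFun hχ 1
      rw [char_one, char_one] at this
      exact_mod_cast this
    have h0 : Module.finrank k V = 0 := by omega
    have : Subsingleton V := Module.finrank_zero_iff.1 h0
    have : Subsingleton W := Module.finrank_zero_iff.1 (hdim ▸ h0)
    exact ⟨LinearEquiv.ofFinrankEq _ _ hdim, fun g x => Subsingleton.elim _ _⟩
  | succ n ih =>
    intro V W _ _ _ _ _ _ ρ σ hn hχ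
    have hdim : Module.finrank k V = Module.finrank k W := by
      have := congrFun hχ 1
      rw [char_one, char_one] at this
      exact_mod_cast this
    rcases subsingleton_or_nontrivial V with hV | hV
    · have : Subsingleton W :=
        Module.finrank_zero_iff.1 (hdim ▸ Module.finrank_zero_of_subsingleton)
      exact ⟨LinearEquiv.ofFinrankEq _ _ hdim, fun g x => Subsingleton.elim _ _⟩
    -- Both dimensions are given by the same character sum, so a nonzero `f : ρ → σ` exists because
    -- the identity of `ρ` is nonzero.
    · have hfin : (Module.finrank k (IntertwiningMap ρ ρ) : k) =
          Module.finrank k (IntertwiningMap ρ σ) := by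
        rw [← card_inv_mul_sum_char_mul_char_eq_finrank,
          ← card_inv_mul_sum_char_mul_char_eq_finrank, hχ]
      have hne : ∃ f : IntertwiningMap ρ σ, f ≠ 0 := by
        by_contra! hall
        have : Subsingleton (IntertwiningMap ρ σ) := ⟨fun a b => (hall a).trans (hall b).symm⟩
        rw [Module.finrank_zero_of_subsingleton (M := IntertwiningMap ρ σ)] at hfin
        have h0 : Module.finrank k (IntertwiningMap ρ ρ) = 0 := by exact_mod_cast hfin
        have : Module.Finite k (IntertwiningMap ρ ρ) := by infer_instance
        have hs := Module.finrank_zero_iff.1 h0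
        obtain ⟨v, hv⟩ := exists_ne (0 : V)
        exact hv (DFunLike.congr_fun (hs.elim (IntertwiningMap.id ρ) 0) v)
      obtain ⟨f, hf⟩ := hne
      obtain ⟨p, hp⟩ := exists_isCompl f.ker
      obtain ⟨q, hq⟩ := exists_isCompl f.range
      have hp' : IsCompl p.toSubmodule (LinearMap.ker f.toLinearMap) :=
        ⟨disjoint_iff.2 (congrArg Subrepresentation.toSubmodule hp.symm.inf_eq_bot),
          codisjoint_iff.2 (congrArg Subrepresentation.toSubmodule hp.symm.sup_eq_top)⟩
      let e : p.toSubmodule ≃ₗ[k] f.range.toSubmodule :=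
        LinearEquiv.ofBijective
          (f.toLinearMap.rangeRestrict.comp p.toSubmodule.subtype) (by
            constructor
            · rw [← LinearMap.ker_eq_bot, LinearMap.ker_eq_bot']
              intro m hm
              have h1 : (m : V) ∈ LinearMap.ker f.toLinearMap := congrArg Subtype.val hm
              exact Subtype.ext ((Submodule.disjoint_def.1 hp'.disjoint) m m.2 h1)
            · rintro ⟨_, v, rfl⟩
              obtain ⟨⟨a, b⟩, rfl⟩ := (Submodule.prodEquivOfIsCompl _ _ hp').surjective v
              refine ⟨a, Subtype.ext ?_⟩
              have hb : f.toLinearMap b = 0 := b.2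
              change f.toLinearMap a = f.toLinearMap (a + b)
              rw [map_add, hb, add_zero])
      have he : ∀ g x, e (p.toRepresentation g x) = f.range.toRepresentation g (e x) :=
        fun g x => Subtype.ext (LinearMap.congr_fun (f.isIntertwining' g) (x : V))
      -- Cancelling the isomorphic summands `p` and `f.range` leaves `f.ker` and `q` with equal
      -- characters and smaller dimension.
      have hchar : f.ker.toRepresentation.character = q.toRepresentation.character := by
        funext g
        have h1 := character_eq_add hp g
        have h2 := character_eq_add hq g
        have h3 : p.toRepresentation.character g = f.range.toRepresentation.character g := by
          unfold character
          rw [← LinearMap.trace_conj' _ e]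
          congr 1
          refine LinearMap.ext fun x => ?_
          rw [LinearEquiv.conj_apply_apply, he, LinearEquiv.apply_symm_apply]
        rw [hχ, h2, h3, add_comm] at h1
        exact (add_right_cancel h1).symm
      have hlt : Module.finrank k f.ker.toSubmodule ≤ n := by
        have : LinearMap.ker f.toLinearMap < ⊤ := lt_top_iff_ne_top.2 fun h =>
          hf (IntertwiningMap.ext (LinearMap.ker_eq_top.1 h))
        have := Submodule.finrank_lt this.ne
        change Module.finrank k (LinearMap.ker f.toLinearMap) ≤ n
        omega
      obtain ⟨t, ht⟩ := ih f.ker.toRepresentation q.toRepresentation hlt hchar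
      exact exists_intertwining_of_isCompl hp.symm hq e t he ht

end Representation

/-! ### Characters separate conjugacy classes -/

/-- If every finite-dimensional representation has the same trace at `a` and `b`, then `a` and `b`
are conjugate. -/
theorem isConj_of_forall_character_eq {k : Type u} [Field k] [IsAlgClosed k] [CharZero k]
    {H : Type} [Group H] [Finite H] {a b : H}
    (h : ∀ (V : Type u) [AddCommGroup V] [Module k V] [FiniteDimensional k V]
      (ρ : Representation k H V), ρ.character a = ρ.character b) : IsConj a b := by
  classical
  have := Fintype.ofFinite H
  have : NeZero (Nat.card H : k) := ⟨Nat.cast_ne_zero.2 Nat.card_pos.ne'⟩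
  -- The sum runs over group elements, so `cl x` is the class sum times the order of the centraliser
  -- of `x`.
  let cl : H → k[H] := fun x => ∑ g : H, MonoidAlgebra.single (g * x * g⁻¹) (1 : k)
  have hcl : ∀ x y, cl x * y = y * cl x := by
    intro x y
    induction y using MonoidAlgebra.induction_linear with
    | zero => simp
    | add y z hy hz => rw [mul_add, add_mul, hy, hz]
    | single g r =>
      simp only [cl, Finset.sum_mul, Finset.mul_sum, MonoidAlgebra.single_mul_single, one_mul,
        mul_one]
      refine Fintype.sum_equiv (Equiv.mulLeft g⁻¹) _ _ fun t => ?_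
      congr 1
      simp [mul_assoc]
  let z := cl a - cl b
  have hz : ∀ y, z * y = y * z := fun y => by simp only [z, sub_mul, mul_sub, hcl]
  -- By Schur, the central element `z` acts on each simple submodule by a scalar. Its trace
  -- vanishes, so the scalar does; by semisimplicity `z` kills `k[H]`, in particular `1`.
  have hzero : z = 0 := by
    let Z : k[H] →ₗ[k[H]] k[H] :=
      { toFun := fun y => z * y
        map_add' := mul_add z
        map_smul' := fun r y => by
          simp only [smul_eq_mul, RingHom.id_apply, ← mul_assoc, hz] }
    have hle : sSup {S : Submodule k[H] k[H] | IsSimpleModule k[H] S} ≤ LinearMap.ker Z := by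
      refine sSup_le fun S hS => ?_
      have hS : IsSimpleModule k[H] S := hS
      have : Nontrivial S := IsSimpleModule.nontrivial k[H] S
      have : Module.Finite k k[H] := inferInstance
      have : Module.Finite k S :=
        Module.Finite.of_injective (S.subtype.restrictScalars k) Subtype.val_injective
      let act : k[H] →ₐ[k] (S →ₗ[k] S) := Algebra.lsmul k k S
      let ρ : Representation k H S := act.toMonoidHom.comp (MonoidAlgebra.of k H)
      have htr : ∀ x, LinearMap.trace k S (act (cl x)) = Nat.card H * ρ.character x := by
        intro x
        have : ∀ g : H, LinearMap.trace k S (act (MonoidAlgebra.single (g * x * g⁻¹) (1 : k))) =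
            ρ.character x := fun g => Representation.char_conj ρ x g
        simp only [cl, map_sum, this]
        simp
      have htr0 : LinearMap.trace k S (act z) = 0 := by
        simp only [z, map_sub, htr, h S ρ, sub_self]
      let Zs : Module.End k[H] S :=
        { toFun := fun s => z • s
          map_add' := smul_add z
          map_smul' := fun r y => by
            simp only [RingHom.id_apply, ← mul_smul, hz] }
      obtain ⟨c, hc⟩ := (IsSimpleModule.algebraMap_end_bijective_of_isAlgClosed
        (A := k[H]) (V := S) k).2 Zs
      have hc' : ∀ s : S, z • s = c • s := fun s => (LinearMap.congr_fun hc s).symm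
      have hact : act z = c • LinearMap.id := LinearMap.ext hc'
      rw [hact, map_smul, LinearMap.trace_id, smul_eq_mul, mul_eq_zero, Nat.cast_eq_zero] at htr0
      have hc0 : c = 0 := htr0.resolve_right Module.finrank_pos.ne'
      intro s hs
      have := hc' ⟨s, hs⟩
      rw [hc0, zero_smul] at this
      exact congrArg Subtype.val this
    rw [IsSemisimpleModule.sSup_simples_eq_top, top_le_iff, LinearMap.ker_eq_top] at hle
    have := LinearMap.congr_fun hle 1
    simpa [Z] using this
  by_contra hab
  have hb : (cl b).coeff a = 0 := by
    simp only [cl, MonoidAlgebra.coeff_sum, Finsupp.finsetSum_apply]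
    refine Finset.sum_eq_zero fun g _ => ?_
    rw [MonoidAlgebra.coeff_single, Finsupp.single_apply, if_neg]
    exact fun hg => hab (isConj_iff.2 ⟨g, hg⟩ : IsConj b a).symm
  have ha : (cl a).coeff a = ((Finset.univ.filter fun g : H => g * a * g⁻¹ = a).card : k) := by
    simp only [cl, MonoidAlgebra.coeff_sum, Finsupp.finsetSum_apply, Finset.card_filter,
      MonoidAlgebra.coeff_single, Finsupp.single_apply]
    push_cast
    rfl
  rw [sub_eq_zero.1 hzero, hb, eq_comm, Nat.cast_eq_zero, Finset.card_eq_zero] at ha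
  have hmem : (1 : H) ∈ Finset.univ.filter fun g : H => g * a * g⁻¹ = a := by simp
  rw [ha] at hmem
  simp at hmem

/-! ### Restriction and duals -/

noncomputable instance Action.resMonoidal {V : Type*} [Category* V] [MonoidalCategory V]
    {G H : Type*} [Monoid G] [Monoid H] (f : G →* H) : (Action.res V f).Monoidal :=
  Functor.CoreMonoidal.toMonoidal
    { εIso := Action.mkIso (Iso.refl _)
        (fun _ => (Category.comp_id _).trans (Category.id_comp _).symm)
      μIso := fun _ _ => Action.mkIso (Iso.refl _)
        (fun _ => (Category.comp_id _).trans (Category.id_comp _).symm)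
      μIso_hom_natural_left := fun _ _ => Action.hom_ext _ _
        ((Category.comp_id _).trans (Category.id_comp _).symm)
      μIso_hom_natural_right := fun _ _ => Action.hom_ext _ _
        ((Category.comp_id _).trans (Category.id_comp _).symm)
      associativity := fun X Y Z => Action.hom_ext _ _ (by
        simp [Action.res])
      left_unitality := fun X => Action.hom_ext _ _ (by
        simp only [Action.leftUnitor_hom_hom, Action.comp_hom, Action.whiskerRight_hom,
          Action.res_map_hom]
        change (λ_ X.V).hom = 𝟙 _ ▷ _ ≫ 𝟙 _ ≫ (λ_ X.V).hom
        simp)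
      right_unitality := fun X => Action.hom_ext _ _ (by
        simp only [Action.rightUnitor_hom_hom, Action.comp_hom, Action.whiskerLeft_hom,
          Action.res_map_hom]
        change (ρ_ X.V).hom = _ ◁ 𝟙 _ ≫ 𝟙 _ ≫ (ρ_ X.V).hom
        simp) }

noncomputable instance Action.resBraided {V : Type*} [Category* V] [MonoidalCategory V]
    [BraidedCategory V]
    {G H : Type*} [Monoid G] [Monoid H] (f : G →* H) : (Action.res V f).Braided where
  braided _ _ := Action.hom_ext _ _ ((Category.id_comp _).trans (Category.comp_id _).symm)

theorem FGModuleCat.rightAdjointMate_apply {k : Type u} [Field k] {V W : FGModuleCat k}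
    (f : V ⟶ W) (ξ : Module.Dual k W) (x : V) :
    DFunLike.coe (F := Module.Dual k V) ((fᘁ).hom.hom ξ) x = ξ (f.hom.hom x) :=
  LinearMap.congr_fun (congrArg (fun t => t.hom.hom) (rightAdjointMate_comp_evaluation f))
    (ξ ⊗ₜ[k] x)

namespace FDRep

variable {k : Type u} [Field k] {G : Type v} [Group G]

theorem character_rightDual (X : FDRep k G) (g : G) : (Xᘁ).character g = X.character g⁻¹ := by
  rw [← char_dual]
  suffices h : (Xᘁ).ρ g = (of (Representation.dual X.ρ)).ρ g from
    congrArg (LinearMap.trace k (Module.Dual k X)) h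
  refine LinearMap.ext fun (ξ : Module.Dual k X) => LinearMap.ext fun (x : X) => ?_
  exact (congrArg (fun t : (Xᘁ).V ⟶ (Xᘁ).V => DFunLike.coe (F := Module.Dual k X) (t.hom.hom ξ) x)
    (Action.rightDual_ρ X g)).trans (FGModuleCat.rightAdjointMate_apply (Action.ρ X g⁻¹) ξ x)

theorem nonempty_iso_of_character_eq [Finite G] [CharZero k] {X Y : FDRep k G}
    (h : X.character = Y.character) : Nonempty (X ≅ Y) := by
  obtain ⟨t, ht⟩ := Representation.exists_intertwining_of_character_eq _ X.ρ Y.ρ le_rfl h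
  refine ⟨Action.mkIso (LinearEquiv.toFGModuleCatIso t) fun g => ?_⟩
  ext x
  exact ht g x

/-- Restriction along a group automorphism as a braided tensor autoequivalence. -/
noncomputable def resAutoequivalence (φ : G ≃* G) :
    BraidedTensorAutoequivalence k (FDRep k G) where
  functor := Action.res _ φ.toMonoidHom
  braided := inferInstance
  additive := ⟨rfl⟩
  linear := ⟨fun _ _ => rfl⟩
  isEquivalence := (Action.resEquiv _ φ).isEquivalence_functor

theorem exists_isDualising [Finite G] [CharZero k] {φ : G ≃* G} (hφ : IsClassInverting φ) :
    (resAutoequivalence (k := k) φ).IsDualising := fun X => by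
  refine nonempty_iso_of_character_eq (funext fun g => ?_)
  obtain ⟨h, hh⟩ := hφ g
  rw [character_rightDual, ← char_conj X g⁻¹ h, ← hh]
  rfl

/-! ### Morphisms and commutative algebras in the representation category -/

/-- The linear map underlying a morphism of representations. -/
def toLin {X Y : FDRep k G} (f : X ⟶ Y) : X →ₗ[k] Y := f.hom.hom.hom

theorem toLin_ρ {X Y : FDRep k G} (f : X ⟶ Y) (g : G) (x : X) :
    toLin f (X.ρ g x) = Y.ρ g (toLin f x) :=
  LinearMap.congr_fun (congrArg (fun t => t.hom.hom) (f.comm g)) x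

theorem toLin_comp {X Y Z : FDRep k G} (f : X ⟶ Y) (g : Y ⟶ Z) (x : X) :
    toLin (f ≫ g) x = toLin g (toLin f x) := rfl

theorem hom_eq_of_toLin {X Y : FDRep k G} {f g : X ⟶ Y} (h : toLin f = toLin g) : f = g :=
  Action.hom_ext _ _ (FGModuleCat.hom_ext h)

/-- An equivariant linear map as a morphism of representations. -/
def mkHom {X Y : FDRep k G} (f : X →ₗ[k] Y) (hf : ∀ g x, f (X.ρ g x) = Y.ρ g (f x)) :
    X ⟶ Y where
  hom := InducedCategory.homMk (ModuleCat.ofHom f)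
  comm g := FGModuleCat.hom_ext (LinearMap.ext (hf g))

theorem epi_of_surjective {X Y : FDRep k G} (f : X ⟶ Y) (hf : Function.Surjective (toLin f)) :
    Epi f where
  left_cancellation a b hab := hom_eq_of_toLin (LinearMap.ext fun y => by
    obtain ⟨x, rfl⟩ := hf y
    exact LinearMap.congr_fun (congrArg toLin hab) x)

theorem surjective_of_epi {X Y : FDRep k G} (f : X ⟶ Y) [Epi f] :
    Function.Surjective (toLin f) := by
  have h : Epi ((forget₂ (FDRep k G) (Rep k G)).map f) := inferInstance
  exact (Rep.epi_iff_surjective _).1 h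

section MonObj

open scoped MonObj

variable (B : FDRep k G) [MonObj B]

/-- The bilinear multiplication of a monoid object. -/
noncomputable def mulMap : B →ₗ[k] B →ₗ[k] B := (TensorProduct.mk k B B).compr₂ (toLin μ[B])

/-- The unit element of a monoid object. -/
noncomputable def unitElt : B := toLin η[B] (1 : k)

variable {B}

theorem mulMap_unitElt_left (x : B) : mulMap B (unitElt B) x = x := by
  have := LinearMap.congr_fun (congrArg toLin (MonObj.one_mul B)) ((1 : k) ⊗ₜ[k] x)
  exact this.trans (one_smul k x)

theorem mulMap_assoc (x y z : B) :
    mulMap B (mulMap B x y) z = mulMap B x (mulMap B y z) :=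
  LinearMap.congr_fun (congrArg toLin (MonObj.mul_assoc B)) ((x ⊗ₜ[k] y) ⊗ₜ[k] z)

theorem mulMap_comm [IsCommMonObj B] (x y : B) : mulMap B x y = mulMap B y x :=
  (LinearMap.congr_fun (congrArg toLin (IsCommMonObj.mul_comm B)) (x ⊗ₜ[k] y)).symm

theorem ρ_mulMap (g : G) (x y : B) :
    B.ρ g (mulMap B x y) = mulMap B (B.ρ g x) (B.ρ g y) :=
  (toLin_ρ μ[B] g (x ⊗ₜ[k] y)).symm

theorem ρ_unitElt (g : G) : B.ρ g (unitElt B) = unitElt B :=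
  (toLin_ρ η[B] g (1 : k)).symm

variable {C : FDRep k G} [MonObj C] (f : B ⟶ C) [IsMonHom f]

theorem toLin_mulMap (x y : B) :
    toLin f (mulMap B x y) = mulMap C (toLin f x) (toLin f y) :=
  LinearMap.congr_fun (congrArg toLin (IsMonHom.mul_hom f)) (x ⊗ₜ[k] y)

theorem toLin_unitElt : toLin f (unitElt B) = unitElt C :=
  LinearMap.congr_fun (congrArg toLin (IsMonHom.one_hom f)) (1 : k)

theorem exists_character [IsAlgClosed k] (B : FDRep k G) [MonObj B] [IsCommMonObj B]
    [Nontrivial B] :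
    ∃ χ : B →ₗ[k] k, χ (unitElt B) = 1 ∧ ∀ x y, χ (mulMap B x y) = χ x * χ y :=
  LinearMap.exists_multiplicative_functional (mulMap B) (unitElt B) mulMap_unitElt_left
    mulMap_comm mulMap_assoc

end MonObj

/-! ### The function algebra and matrix coefficients -/

section FunctionAlgebra

variable {H : Type} [Group H] [Finite H] (e : G ≃* H)

/-- Functions on a finite group, with the action by right translation. -/
def functionRep : Representation k G (H → k) where
  toFun g := LinearMap.funLeft k k (fun t => t * e g)
  map_one' := by ext; simp [LinearMap.funLeft]
  map_mul' _ _ := by ext; simp [LinearMap.funLeft, mul_assoc]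

variable (k) in
/-- Functions on a finite group as an object of `FDRep k G`. -/
noncomputable abbrev functionAlgebra : FDRep k G := FDRep.of (functionRep (k := k) e)

noncomputable instance : MonObj (functionAlgebra k e) where
  one := mkHom (X := 𝟙_ (FDRep k G)) (Y := functionAlgebra k e)
    (Algebra.linearMap k (H → k)) (fun _ _ => rfl)
  mul := mkHom (X := functionAlgebra k e ⊗ functionAlgebra k e) (Y := functionAlgebra k e)
    (LinearMap.mul' k (H → k)) (fun g x => by
      induction x using TensorProduct.induction_on with
      | zero => simp
      | tmul a b => rfl
      | add a b ha hb => simp only [map_add, ha, hb])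
  one_mul := hom_eq_of_toLin (TensorProduct.ext' fun a b => by
    exact (Algebra.smul_def (A := H → k) a b).symm)
  mul_one := hom_eq_of_toLin (TensorProduct.ext' fun a b => by
    exact (mul_comm _ _).trans (Algebra.smul_def (A := H → k) b a).symm)
  mul_assoc := hom_eq_of_toLin (TensorProduct.ext_threefold fun a b c => by
    exact mul_assoc (G := H → k) a b c)

instance : IsCommMonObj (functionAlgebra k e) where
  mul_comm := hom_eq_of_toLin (TensorProduct.ext' fun a b => by
    exact mul_comm (G := H → k) b a)

/-- The map from a representation to the function algebra given by the matrix coefficients of a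
linear functional. -/
noncomputable def coeffHom (X : FDRep k G) : Module.Dual k X →ₗ[k] (X ⟶ functionAlgebra k e) where
  toFun ξ := mkHom (Y := functionAlgebra k e)
    (LinearMap.pi fun t => ξ.comp (X.ρ (e.symm t)))
    (fun g x => funext fun t => by
      change ξ (X.ρ (e.symm t) (X.ρ g x)) = ξ (X.ρ (e.symm (t * e g)) x)
      simp)
  map_add' _ _ := rfl
  map_smul' _ _ := rfl

theorem toLin_coeffHom {X : FDRep k G} (ξ : Module.Dual k X) (x : X) (t : H) :
    (show H → k from toLin (coeffHom e X ξ) x) t = ξ (X.ρ (e.symm t) x) := rfl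

/-- Left translation as an endomorphism of the function algebra. -/
noncomputable def translation (h : H) : functionAlgebra k e ⟶ functionAlgebra k e :=
  coeffHom e (functionAlgebra k e) (LinearMap.proj h : (H → k) →ₗ[k] k)

theorem toLin_translation (h : H) (f : H → k) (t : H) :
    (show H → k from toLin (translation (k := k) e h) f) t = f (h * t) := by
  refine (toLin_coeffHom e (X := functionAlgebra k e) _ f t).trans ?_
  change f (h * e (e.symm t)) = _
  simp

instance (h : H) : IsMonHom (translation (k := k) e h) where
  one_hom := hom_eq_of_toLin (LinearMap.ext fun _ => rfl)
  mul_hom := hom_eq_of_toLin (TensorProduct.ext' fun _ _ => rfl)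

/-- Left translations of the function algebra encode the action on every dual space at once. -/
theorem coeffHom_translation {X : FDRep k G} (ξ : Module.Dual k X) (g : G) :
    coeffHom e X ξ ≫ translation (k := k) e (e g) = coeffHom e X (ξ.comp (X.ρ g)) :=
  hom_eq_of_toLin (LinearMap.ext fun x => funext fun t => by
    change (show H → k from toLin (translation e (e g)) (toLin (coeffHom e X ξ) x)) t = _
    rw [toLin_translation e (e g) (toLin (coeffHom e X ξ) x) t]
    change ξ (X.ρ (e.symm (e g * t)) x) = ξ (X.ρ g (X.ρ (e.symm t) x))
    simp)

open scoped MonObj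

/-- If `ξ x ≠ 0`, the coefficient function of `t⁻¹ x` takes the value `ξ x` at `t`; multiplying it
by a multiple of the delta function at `t` isolates that point. -/
theorem epi_whiskerLeft_coeffHom_mul {X : FDRep k G} {ξ : Module.Dual k X} (hξ : ξ ≠ 0) :
    Epi (functionAlgebra k e ◁ coeffHom e X ξ ≫ μ[functionAlgebra k e]) := by
  classical
  have := Fintype.ofFinite H
  obtain ⟨x, hx⟩ : ∃ x, ξ x ≠ 0 := by
    by_contra! h
    exact hξ (LinearMap.ext h)
  refine epi_of_surjective _ fun (f : H → k) => ?_
  refine ⟨∑ t : H, (Pi.single t (f t * (ξ x)⁻¹) : H → k) ⊗ₜ[k] X.ρ (e.symm t⁻¹) x, ?_⟩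
  rw [map_sum]
  have key : ∀ t : H, toLin (functionAlgebra k e ◁ coeffHom e X ξ ≫ μ[functionAlgebra k e])
      ((Pi.single t (f t * (ξ x)⁻¹) : H → k) ⊗ₜ[k] X.ρ (e.symm t⁻¹) x) =
      (Pi.single t (f t) : H → k) := by
    intro t
    refine funext fun s => ?_
    change (Pi.single t (f t * (ξ x)⁻¹) : H → k) s *
      ξ (X.ρ (e.symm s) (X.ρ (e.symm t⁻¹) x)) = _
    rcases eq_or_ne s t with rfl | hs
    · simp [hx]
    · simp [hs]
  exact (Finset.sum_congr rfl fun t _ => key t).trans (Finset.univ_sum_single f)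

end FunctionAlgebra

/-! ### Reconstructing a group endomorphism from the functor -/

open scoped Obj MonObj

variable {H : Type} [Group H] [Finite H] (e : G ≃* H)
  (F : FDRep k G ⥤ FDRep k G) [F.Additive] [F.Linear k]

/-- A functional `χ` on the image of the function algebra transports functionals on `X` to
functionals on `F X`. -/
noncomputable def transport (χ : Module.Dual k (F.obj (functionAlgebra k e))) (X : FDRep k G) :
    Module.Dual k X →ₗ[k] Module.Dual k (F.obj X) where
  toFun ξ := χ.comp (toLin (F.map (coeffHom e X ξ)))
  map_add' ξ ζ := by
    rw [map_add, F.map_add]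
    exact LinearMap.comp_add _ _ _
  map_smul' c ξ := by
    rw [map_smul, F.map_smul]
    exact LinearMap.comp_smul _ _ _

variable {F}
variable (χ : Module.Dual k (F.obj (functionAlgebra k e)))

theorem transport_apply {X : FDRep k G} (ξ : Module.Dual k X) (y : F.obj X) :
    transport e F χ X ξ y = χ (toLin (F.map (coeffHom e X ξ)) y) := rfl

/-- A relation between `g` and `h` checked on the function algebra alone passes to all `X` by
functoriality. -/
theorem transport_comp_ρ {g h : G}
    (hgh : ∀ y, χ ((F.obj (functionAlgebra k e)).ρ g y) =
      χ (toLin (F.map (translation e (e h))) y)) {X : FDRep k G} (ξ : Module.Dual k X) :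
    transport e F χ X (ξ.comp (X.ρ h)) = (transport e F χ X ξ).comp ((F.obj X).ρ g) := by
  refine LinearMap.ext fun y => ?_
  rw [LinearMap.comp_apply, transport_apply, transport_apply, ← coeffHom_translation, F.map_comp,
    toLin_comp, ← hgh, toLin_ρ]

/-- If a nonzero `ξ` is sent to zero, multiplicativity makes `χ` vanish on the image of `F(A) ⊗ F(X)
⟶ F(A)`. `F` preserves the epimorphism `A ⊗ X ⟶ A`, so that image contains the unit, where `χ` is
`1`. -/
theorem transport_injective [F.Braided] [F.IsEquivalence]
    (h1 : χ (unitElt (F.obj (functionAlgebra k e))) = 1)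
    (hmul : ∀ x y, χ (mulMap (F.obj (functionAlgebra k e)) x y) = χ x * χ y) (X : FDRep k G) :
    Function.Injective (transport e F χ X) := by
  rw [← LinearMap.ker_eq_bot, LinearMap.ker_eq_bot']
  intro ξ hξ
  by_contra hne
  have := epi_whiskerLeft_coeffHom_mul e hne
  have hepi : Epi (Functor.LaxMonoidal.μ F (functionAlgebra k e) X ≫
      F.map (functionAlgebra k e ◁ coeffHom e X ξ ≫ μ[functionAlgebra k e])) := inferInstance
  have heq : Functor.LaxMonoidal.μ F (functionAlgebra k e) X ≫
      F.map (functionAlgebra k e ◁ coeffHom e X ξ ≫ μ[functionAlgebra k e]) =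
      F.obj (functionAlgebra k e) ◁ F.map (coeffHom e X ξ) ≫ μ[F.obj (functionAlgebra k e)] := by
    rw [F.map_comp, ← Functor.LaxMonoidal.μ_natural_right_assoc, Functor.obj.μ_def]
  rw [heq] at hepi
  have hzero : χ.comp (toLin (F.obj (functionAlgebra k e) ◁ F.map (coeffHom e X ξ) ≫
      μ[F.obj (functionAlgebra k e)])) = 0 :=
    TensorProduct.ext' fun b y => by
      refine (hmul b (toLin (F.map (coeffHom e X ξ)) y)).trans ?_
      rw [← transport_apply, hξ, LinearMap.zero_apply, mul_zero]
      rfl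
  obtain ⟨z, hz⟩ := surjective_of_epi
    (F.obj (functionAlgebra k e) ◁ F.map (coeffHom e X ξ) ≫ μ[F.obj (functionAlgebra k e)])
    (unitElt (F.obj (functionAlgebra k e)))
  have := LinearMap.congr_fun hzero z
  rw [LinearMap.comp_apply, hz, h1] at this
  exact one_ne_zero this

/-- The comparison map from the image of the function algebra to the function algebra. -/
noncomputable def comparison : F.obj (functionAlgebra k e) →ₗ[k] (H → k) :=
  LinearMap.pi fun h => χ.comp (toLin (F.map (translation e h)))

theorem transport_functionAlgebra (ξ : Module.Dual k (H → k))
    (y : F.obj (functionAlgebra k e)) :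
    transport e F χ (functionAlgebra k e) ξ y = ξ (comparison e χ y) := by
  classical
  have := Fintype.ofFinite H
  have hξ : ξ = ∑ h : H, ξ (Pi.single h 1) • (LinearMap.proj h : (H → k) →ₗ[k] k) := by
    refine LinearMap.pi_ext' fun h => LinearMap.ext_ring ?_
    simp [Pi.single_apply]
  have h2 : transport e F χ (functionAlgebra k e) ξ =
      ∑ h : H, ξ (Pi.single h 1) • transport e F χ (functionAlgebra k e)
        (LinearMap.proj h : (H → k) →ₗ[k] k) := by
    conv_lhs => rw [hξ]
    exact (map_sum _ _ _).trans (Finset.sum_congr rfl fun h _ => map_smul _ _ _)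
  rw [h2]
  conv_rhs => rw [hξ]
  simp only [LinearMap.sum_apply, LinearMap.smul_apply]
  rfl

/-- A functional vanishing on the range would be transported to zero. -/
theorem comparison_surjective
    (hinj : Function.Injective (transport e F χ (functionAlgebra k e))) :
    Function.Surjective (comparison e χ) := by
  rw [← LinearMap.range_eq_top]
  by_contra hne
  obtain ⟨ξ, hξ0, hξ⟩ := Submodule.exists_le_ker_of_lt_top _ (lt_top_iff_ne_top.2 hne)
  refine hξ0 (hinj (?_ : transport e F χ (functionAlgebra k e) ξ = transport e F χ _ 0))
  rw [map_zero]
  refine LinearMap.ext fun y => ?_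
  rw [transport_functionAlgebra]
  exact hξ ⟨y, rfl⟩

/-- `comparison` is an algebra isomorphism onto `H → k`, and `χ ∘ ρ(g)` is multiplicative. Algebra
maps `(H → k) → k` are evaluations, and evaluation at a point corresponds to `χ` after the image of
a translation. -/
theorem exists_ρ_eq_translation [F.Braided] [F.IsEquivalence]
    (hdim : Module.finrank k (F.obj (functionAlgebra k e)) =
      Module.finrank k (functionAlgebra k e))
    (h1 : χ (unitElt (F.obj (functionAlgebra k e))) = 1)
    (hmul : ∀ x y, χ (mulMap (F.obj (functionAlgebra k e)) x y) = χ x * χ y) (g : G) :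
    ∃ h : G, ∀ y, χ ((F.obj (functionAlgebra k e)).ρ g y) =
      χ (toLin (F.map (translation e (e h))) y) := by
  have hs := comparison_surjective e χ (transport_injective e χ h1 hmul _)
  have hb : Function.Injective (comparison e χ) :=
    (LinearMap.injective_iff_surjective_of_finrank_eq_finrank hdim).2 hs
  let c : F.obj (functionAlgebra k e) ≃ₗ[k] (H → k) := LinearEquiv.ofBijective _ ⟨hb, hs⟩
  have hc1 : c (unitElt _) = 1 := funext fun h => by
    change χ (toLin (F.map (translation e h)) (unitElt _)) = 1
    rw [toLin_unitElt, h1]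
  have hcmul : ∀ x y, c (mulMap _ x y) = c x * c y := fun x y => funext fun h => by
    change χ (toLin (F.map (translation e h)) (mulMap _ x y)) = _
    rw [toLin_mulMap, hmul]
    rfl
  let ψ : (H → k) →ₐ[k] k := AlgHom.ofLinearMap
    ((χ.comp ((F.obj (functionAlgebra k e)).ρ g)).comp c.symm.toLinearMap)
    (by
      change χ ((F.obj (functionAlgebra k e)).ρ g (c.symm 1)) = 1
      rw [← hc1, LinearEquiv.symm_apply_apply, ρ_unitElt, h1])
    (fun x y => by
      change χ ((F.obj (functionAlgebra k e)).ρ g (c.symm (x * y))) =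
        χ ((F.obj (functionAlgebra k e)).ρ g (c.symm x)) *
          χ ((F.obj (functionAlgebra k e)).ρ g (c.symm y))
      obtain ⟨x, rfl⟩ := c.surjective x
      obtain ⟨y, rfl⟩ := c.surjective y
      rw [← hcmul]
      simp only [LinearEquiv.symm_apply_apply]
      rw [ρ_mulMap, hmul])
  obtain ⟨h, hh⟩ := ψ.eq_piEvalAlgHom
  refine ⟨e.symm h, fun y => ?_⟩
  have := DFunLike.congr_fun hh (c y)
  change χ ((F.obj (functionAlgebra k e)).ρ g (c.symm (c y))) = c y h at this
  rw [LinearEquiv.symm_apply_apply] at this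
  rw [this, MulEquiv.apply_symm_apply]
  rfl

variable (F) in
/-- A braided autoequivalence preserving dimensions acts on characters as an endomorphism of the
group. -/
theorem exists_monoidHom_character_obj [IsAlgClosed k] (e : G ≃* H) [F.Braided]
    [F.IsEquivalence]
    (hdim : ∀ X : FDRep k G, Module.finrank k (F.obj X) = Module.finrank k X) :
    ∃ φ : G →* G, ∀ (X : FDRep k G) (g : G), (F.obj X).character g = X.character (φ g) := by
  have hnt : Nontrivial (F.obj (functionAlgebra k e)) := by
    have := Fintype.ofFinite H
    apply Module.nontrivial_of_finrank_pos (R := k)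
    rw [hdim]
    change 0 < Module.finrank k (H → k)
    rw [Module.finrank_pi]
    exact Fintype.card_pos
  obtain ⟨χ, h1, hmul⟩ := exists_character (F.obj (functionAlgebra k e))
  choose φ hφ using exists_ρ_eq_translation e χ (hdim _) h1 hmul
  have key : ∀ (g : G) (X : FDRep k G) (ξ : Module.Dual k X),
      transport e F χ X (ξ.comp (X.ρ (φ g))) = (transport e F χ X ξ).comp ((F.obj X).ρ g) :=
    fun g X ξ => transport_comp_ρ e χ (hφ g) ξ
  have inj := transport_injective e χ h1 hmul
  refine ⟨MonoidHom.mk' φ fun a b => ?_, fun X g => ?_⟩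
  -- Evaluation at `1` after the action of a group element is evaluation at that element, so delta
  -- functions tell the elements apart.
  · let ev : Module.Dual k (functionAlgebra k e) := (LinearMap.proj 1 : (H → k) →ₗ[k] k)
    have h : ev.comp ((functionAlgebra k e).ρ (φ (a * b))) =
        (ev.comp ((functionAlgebra k e).ρ (φ a))).comp ((functionAlgebra k e).ρ (φ b)) := by
      apply inj
      rw [key, key, key, map_mul]
      rfl
    classical
    have h' := LinearMap.congr_fun h (Pi.single (e (φ a * φ b)) 1 : H → k)
    rw [LinearMap.comp_assoc, ← Module.End.mul_eq_comp, ← map_mul] at h'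
    change (Pi.single (e (φ a * φ b)) 1 : H → k) (1 * e (φ (a * b))) =
      (Pi.single (e (φ a * φ b)) 1 : H → k) (1 * e (φ a * φ b)) at h'
    simp only [one_mul, Pi.single_eq_same] at h'
    by_contra hne
    rw [Pi.single_eq_of_ne (fun h => hne (e.injective h))] at h'
    exact zero_ne_one h'
  -- Traces are compared on dual spaces, where `transport` intertwines the transposes.
  · let t : Module.Dual k X ≃ₗ[k] Module.Dual k (F.obj X) := LinearEquiv.ofBijective
      (transport e F χ X) ⟨inj X, (LinearMap.injective_iff_surjective_of_finrank_eq_finrank (by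
        rw [Subspace.dual_finrank_eq, Subspace.dual_finrank_eq, hdim])).1 (inj X)⟩
    change LinearMap.trace k _ ((F.obj X).ρ g) = LinearMap.trace k _ (X.ρ (φ g))
    rw [← LinearMap.trace_transpose' ((F.obj X).ρ g), ← LinearMap.trace_transpose' (X.ρ (φ g)),
      ← LinearMap.trace_conj' _ t]
    congr 1
    refine LinearMap.ext fun ζ => ?_
    obtain ⟨ξ, rfl⟩ := t.surjective ζ
    rw [LinearEquiv.conj_apply_apply, LinearEquiv.symm_apply_apply]
    exact (key g X ξ).symm

end FDRep

/-! ### The main equivalence -/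

theorem mainTheorem2 {k : Type u} [Field k] [IsAlgClosed k] [CharZero k]
    {G : Type v} [Group G] [Finite G] :
    (∃ F : BraidedTensorAutoequivalence k (FDRep k G), F.IsDualising) ↔
      ∃ φ : G ≃* G, IsClassInverting φ := by
  refine ⟨fun ⟨F, hF⟩ => ?_, fun ⟨φ, hφ⟩ => ⟨_, FDRep.exists_isDualising hφ⟩⟩
  have := F.braided
  have := F.additive
  have := F.linear
  have := F.isEquivalence
  -- Objects have carriers in the universe of `k`, so functions are taken on a copy of `G` in
  -- `Type`.
  let e : G ≃* Shrink.{0} G := Shrink.mulEquiv.symm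
  have : Finite (Shrink.{0} G) := Finite.of_equiv G e.toEquiv
  have hchar : ∀ (X : FDRep k G) (g : G),
      (F.functor.obj X).character g = X.character g⁻¹ := fun X g => by
    obtain ⟨i⟩ := hF X
    rw [FDRep.char_iso i, FDRep.character_rightDual]
  obtain ⟨φ, hφ⟩ := FDRep.exists_monoidHom_character_obj F.functor e fun X => by
    have := hchar X 1
    rw [inv_one, FDRep.char_one, FDRep.char_one] at this
    exact_mod_cast this
  have hconj : ∀ g, IsConj g⁻¹ (φ g) := fun g => by
    have h : IsConj (e g⁻¹) (e (φ g)) := isConj_of_forall_character_eq (k := k) fun V _ _ _ ρ => by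
      have := (hchar (FDRep.of (ρ.comp e.toMonoidHom)) g).symm.trans (hφ _ g)
      exact this
    obtain ⟨c, hc⟩ := isConj_iff.1 h
    refine isConj_iff.2 ⟨e.symm c, e.injective ?_⟩
    simpa using hc
  have hinj : Function.Injective φ := by
    rw [injective_iff_map_eq_one]
    intro g hg
    have := hconj g
    rw [hg, isConj_one_left] at this
    exact inv_eq_one.1 this
  refine ⟨MulEquiv.ofBijective φ (Finite.injective_iff_bijective.1 hinj), fun g => ?_⟩
  obtain ⟨c, hc⟩ := isConj_iff.1 (hconj g)
  exact ⟨c, hc.symm⟩
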